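/- Let $p\ge 1$ be an integer, let $X\subset\mathbb R$ be a finite nonempty set of spin values (so $|S_i|\le C$ for some constant $C<\infty$), and let $\beta>0$, $J>0$, $J_0\ge 0$. Let $\alpha=\alpha_N\in(0,1]$ and $b=b_N\in(0,1]$ be functions of $N$ such that $x_N:=\alpha_N N^{b_N(p-1)}\to\infty$ as $N\to\infty$. For real couplings $g=(g_{i_1\cdots i_p})_{1\le i_1<\cdots<i_p\le N}$ put $$\Phi_N(g)=-\frac1{N\beta}\log\sum_{S\in X^N}\exp\Big(\beta\sum_{1\le i_1<\cdots<i_p\le N}g_{i_1\cdots i_p}S_{i_1}\cdots S_{i_p}\Big).$$ For each $N$ let $K_{i_1\cdots i_p}$ be i.i.d. Bernoulli variables with $\Pr[K_{i_1\cdots i_p}=1]=\alpha_N N^{(b_N-1)(p-1)}$ and $\Pr[K_{i_1\cdots i_p}=0]=1-\alpha_N N^{(b_N-1)(p-1)}$. Ferromagnetic models. Let $$f^{\mathrm{dMF,F}}_N=\mathbb E\Big[\Phi_N\Big(\frac{p!}{2x_N}K\Big)\Big],\qquad f^{\mathrm{MF,F}}_N=\Phi_N\Big(\frac{p!}{2N^{p-1}}\Big),$$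 where in the second expression all couplings equal the given constant. Spin-glass models. Let $$f^{\mathrm{dMF,SG}}_N=\mathbb E\Big[\Phi_N\Big(\sqrt{\tfrac{p!}{2x_N}}\,K J_d\Big)\Big],\qquad f^{\mathrm{MF,SG}}_N=\mathbb E\Big[\Phi_N\Big(\sqrt{\tfrac{p!}{2N^{p-1}}}\,G\Big)\Big],$$ where $(KJ_d)_{i_1\cdots i_p}=K_{i_1\cdots i_p}J_{d,i_1\cdots i_p}$, the $G_{i_1\cdots i_p}$ are i.i.d. Gaussian with mean $J_0\sqrt{p!/(2N^{p-1})}$ and variance $J^2$, and the $J_{d,i_1\cdots i_p}$ are i.i.d., independent of $K$, with a law (which may depend on $N$) that is either (i) Gaussian with mean $J_0\sqrt{p!/(2x_N)}$ and variance $J^2$; or (ii) any discrete law supported in $[-B,B]$, with $B<\infty$ independent of $N$, such that as $N\to\infty$ $$\mathbb E[J_d]=J_0\sqrt{\frac{p!}{2x_N}}+\mathcal O(x_N^{-1}),\qquad \mathbb E[J_d^2]=J^2+\mathcal O(x_N^{-1/2}).$$ Then, for the ferromagnetic models and for the spin-glass models in each of the cases (i) and (ii), the thermodynamic limit $\lim_{N\to\infty}f^{\mathrm{dMF}}_N$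 of the quenched free energy of the diluted model exists in $\mathbb R$ if and only if the thermodynamic limit $\lim_{N\to\infty}f^{\mathrm{MF}}_N$ of the undiluted mean-field model does, and the two limits are then equal. In particular, whenever the thermodynamic limit of the quenched free energy of the diluted model is assumed to exist, $$f_{\mathrm{MF,F}}=f_{\mathrm{dMF,F}},\qquad f_{\mathrm{MF,SG}}=f_{\mathrm{dMF,SG}}.$$ -/

import Mathlib

open MeasureTheory ProbabilityTheory Filter Topology Asymptotics

noncomputable section

namespace DilutedPSpin

/-- The `p`-element sets of sites, that is, the tuples `i₁ < ⋯ < i_p` in a system of size `N`. -/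
abbrev Edge (p N : ℕ) : Type := {s : Finset (Fin N) // s.card = p}

/-- The `p`-spin Hamiltonian `H(S) = - ∑ g_{i₁⋯i_p} S_{i₁} ⋯ S_{i_p}` with total couplings `g`. -/
def hamiltonian (p N : ℕ) (g : Edge p N → ℝ) (S : Fin N → ℝ) : ℝ :=
  -∑ e : Edge p N, g e * ∏ i ∈ e.1, S i

/-- The partition function `Tr exp (-β H)`: every spin runs over the finite set `X` of values. -/
def partitionFunction (X : Finset ℝ) (β : ℝ) (p N : ℕ) (g : Edge p N → ℝ) : ℝ :=
  ∑ S ∈ Fintype.piFinset (fun _ : Fin N => X), Real.exp (-β * hamiltonian p N g S)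

/-- The free energy per site `-(1/(Nβ)) log Z` of a system of size `N` with couplings `g`. -/
def freeEnergy (X : Finset ℝ) (β : ℝ) (p N : ℕ) (g : Edge p N → ℝ) : ℝ :=
  -(1 / ((N : ℝ) * β)) * Real.log (partitionFunction X β p N g)

/-- The dilution scale `α N^{b(p-1)}`. -/
def scale (α b : ℝ) (p N : ℕ) : ℝ := α * (N : ℝ) ^ (b * ((p : ℝ) - 1))

/-- The probability `α N^{(b-1)(p-1)}` that an interaction is present. -/
def bondProb (α b : ℝ) (p N : ℕ) : ℝ := α * (N : ℝ) ^ ((b - 1) * ((p : ℝ) - 1))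

/-- Where the parameters are admissible, the bond probability lies in the unit interval. -/
theorem bondProb_mem_unitInterval {α b : ℝ} {p N : ℕ} (hα : α ∈ Set.Ioc (0 : ℝ) 1)
    (hb : b ∈ Set.Ioc (0 : ℝ) 1) (hp : 1 ≤ p) (hN : 1 ≤ N) :
    bondProb α b p N ∈ Set.Icc (0 : ℝ) 1 := by
  have hN' : (1 : ℝ) ≤ N := by exact_mod_cast hN
  have hp' : (1 : ℝ) ≤ p := by exact_mod_cast hp
  have h0 : (0 : ℝ) ≤ (N : ℝ) ^ ((b - 1) * ((p : ℝ) - 1)) := by positivity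
  have h1 : (N : ℝ) ^ ((b - 1) * ((p : ℝ) - 1)) ≤ 1 :=
    Real.rpow_le_one_of_one_le_of_nonpos hN'
      (mul_nonpos_of_nonpos_of_nonneg (by linarith [hb.2]) (by linarith))
  exact ⟨mul_nonneg hα.1.le h0, mul_le_one₀ hα.2 h0 h1⟩

/-- The Bernoulli law on `{0, 1}` of one dilution variable `K`. The projection to the unit interval
is the identity in every system with at least one site, by `bondProb_mem_unitInterval`. -/
def bondLaw (α b : ℝ) (p N : ℕ) : Measure ℝ :=
  bernoulliMeasure (1 : ℝ) 0 (Set.projIcc (0 : ℝ) 1 zero_le_one (bondProb α b p N))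

/-- The law of the i.i.d. dilution variables. -/
def dilutionLaw (α b : ℝ) (p N : ℕ) : Measure (Edge p N → ℝ) :=
  Measure.pi fun _ => bondLaw α b p N

/-- Finite-size quenched free energy of the diluted ferromagnet. -/
def quenchedDilutedFerro (X : Finset ℝ) (β : ℝ) (p : ℕ) (α b : ℝ) (N : ℕ) : ℝ :=
  ∫ K, freeEnergy X β p N (fun e => (p.factorial : ℝ) / (2 * scale α b p N) * K e)
    ∂(dilutionLaw α b p N)

/-- Finite-size free energy of the undiluted mean-field ferromagnet. -/
def meanFieldFerro (X : Finset ℝ) (β : ℝ) (p N : ℕ) : ℝ :=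
  freeEnergy X β p N (fun _ => (p.factorial : ℝ) / (2 * (N : ℝ) ^ (p - 1)))

/-- Finite-size quenched free energy of the diluted spin glass: the dilution variables `K` and the
couplings `J` are all independent, and every coupling has the law `ν`. -/
def quenchedDilutedGlass (X : Finset ℝ) (β : ℝ) (p : ℕ) (α b : ℝ) (ν : Measure ℝ) (N : ℕ) : ℝ :=
  ∫ KJ : (Edge p N → ℝ) × (Edge p N → ℝ),
    freeEnergy X β p N
      (fun e => √((p.factorial : ℝ) / (2 * scale α b p N)) * (KJ.1 e * KJ.2 e))
    ∂((dilutionLaw α b p N).prod (Measure.pi fun _ => ν))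

/-- The Gaussian law, of variance `J²`, of a coupling of the diluted spin glass. -/
def gaussianCoupling (J₀ J : ℝ) (α b : ℝ) (p N : ℕ) : Measure ℝ :=
  gaussianReal (J₀ * √((p.factorial : ℝ) / (2 * scale α b p N))) (Real.toNNReal (J ^ 2))

/-- Finite-size quenched free energy of the undiluted mean-field spin glass. -/
def quenchedMeanFieldGlass (X : Finset ℝ) (β : ℝ) (p : ℕ) (J₀ J : ℝ) (N : ℕ) : ℝ :=
  ∫ g : Edge p N → ℝ,
    freeEnergy X β p N (fun e => √((p.factorial : ℝ) / (2 * (N : ℝ) ^ (p - 1))) * g e)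
    ∂(Measure.pi fun _ : Edge p N =>
      gaussianReal (J₀ * √((p.factorial : ℝ) / (2 * (N : ℝ) ^ (p - 1)))) (Real.toNNReal (J ^ 2)))

/-- Bounded discrete coupling laws `ν N` with the prescribed first two moments up to corrections;
the bound is uniform in the system size. -/
structure IsBoundedDiscreteCoupling (J₀ J : ℝ) (p : ℕ) (α b : ℕ → ℝ) (ν : ℕ → Measure ℝ) :
    Prop where
  isProbabilityMeasure : ∀ N, IsProbabilityMeasure (ν N)
  discrete : ∀ N, ∃ D : Set ℝ, D.Countable ∧ ν N Dᶜ = 0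
  bounded : ∃ B : ℝ, ∀ N, ν N (Set.Icc (-B) B)ᶜ = 0
  mean : (fun N => (∫ x, x ∂(ν N)) - J₀ * √((p.factorial : ℝ) / (2 * scale (α N) (b N) p N)))
    =O[atTop] fun N => (scale (α N) (b N) p N)⁻¹
  secondMoment : (fun N => (∫ x, x ^ 2 ∂(ν N)) - J ^ 2)
    =O[atTop] fun N => (√(scale (α N) (b N) p N))⁻¹

end DilutedPSpin

end

/-!
The difference between the diluted and the mean-field quenched free energy tends to zero, by
Lindeberg's replacement method. The free energy per site depends on each coupling through a
log-sum-exp, so that it has in each coupling a second-order Taylor expansion, uniform in all the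
others, with coefficients and cubic remainder of order `1 / N` (`exists_taylor_freeEnergy`; the
remainder is a third Gibbs cumulant of a bounded observable). Exchanging the law of one coupling
therefore costs `1 / N` times the discrepancies of the first two moments plus the third absolute
moments, and exchanging all of them costs at most `N ^ p` times that
(`abs_integral_pi_sub_integral_pi_le`). Two families of couplings are thus equivalent as soon as
these quantities are `o (N ^ (1 - p))` (`tendsto_integral_freeEnergy_sub`).

At dilution scale `x` a bond is present with probability `x / N ^ (p - 1)`. In the ferromagnet the
means of the two couplings agree exactly. In the spin glass the squared normalization
`p! / (2 x)` times the bond probability is the squared mean-field normalization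
`p! / (2 N ^ (p - 1))`: the means agree up to the error in the mean of `J_d`, both second
moments times `N ^ (p - 1)` tend to `J ^ 2 p! / 2`, and the third moments carry one more factor
`x ^ (-1/2)` or `N ^ (-(p - 1) / 2)`. Since `x ≤ N ^ (p - 1)`, both vanish when `x → ∞`. This
also settles `p = 1`, where `x ≤ 1` and the hypothesis `x → ∞` cannot hold.
-/

namespace DilutedPSpin

/-! ### Taylor expansion of a log-sum-exp along a line -/

/-- A derivative of size `C |x|ⁿ` integrates to an increment of size `C |t|ⁿ⁺¹`. -/
theorem abs_le_of_abs_hasDerivAt_le {φ φ' : ℝ → ℝ} {C : ℝ} {n : ℕ} (hC : 0 ≤ C)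
    (hφ : ∀ x, HasDerivAt φ (φ' x) x) (h0 : φ 0 = 0) (hb : ∀ x, |φ' x| ≤ C * |x| ^ n) (t : ℝ) :
    |φ t| ≤ C * |t| ^ (n + 1) := by
  have hmem : ∀ x ∈ Set.Icc (-|t|) |t|, |x| ≤ |t| := fun x hx => abs_le.2 hx
  have h := (convex_Icc (-|t|) |t|).norm_image_sub_le_of_norm_hasDerivWithin_le
    (f := φ) (f' := φ') (C := C * |t| ^ n) (x := 0) (y := t)
    (fun x _ => (hφ x).hasDerivWithinAt)
    (fun x hx => (hb x).trans (by have := hmem x hx; gcongr))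
    (by simp) (abs_le.1 le_rfl)
  simpa [h0, pow_succ, mul_assoc] using h

/-- The partition function `∑ exp (cᵢ + t aᵢ)` with the insertion `aᵢᵏ`, an unnormalized `k`-th
moment of the Gibbs measure. -/
noncomputable def gibbsMoment {σ : Type*} (s : Finset σ) (c a : σ → ℝ) (k : ℕ) (t : ℝ) : ℝ :=
  ∑ i ∈ s, a i ^ k * Real.exp (c i + t * a i)

section GibbsMoment

variable {σ : Type*} {s : Finset σ} (c : σ → ℝ) {a : σ → ℝ} {A : ℝ}

theorem gibbsMoment_zero_pos (hs : s.Nonempty) (t : ℝ) : 0 < gibbsMoment s c a 0 t := by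
  unfold gibbsMoment
  exact Finset.sum_pos (fun i _ => by positivity) hs

theorem hasDerivAt_gibbsMoment (k : ℕ) (t : ℝ) :
    HasDerivAt (gibbsMoment s c a k) (gibbsMoment s c a (k + 1) t) t := by
  unfold gibbsMoment
  refine HasDerivAt.fun_sum fun i _ => ?_
  refine (((((hasDerivAt_id t).mul_const (a i)).const_add (c i)).exp).const_mul
    (a i ^ k)).congr_deriv ?_
  simp only [id]
  ring

theorem abs_gibbsMoment_div_le (hs : s.Nonempty) (ha : ∀ i ∈ s, |a i| ≤ A) (k : ℕ) (t : ℝ) :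
    |gibbsMoment s c a k t / gibbsMoment s c a 0 t| ≤ A ^ k := by
  have h0 := gibbsMoment_zero_pos (a := a) c hs t
  rw [abs_div, abs_of_pos h0, div_le_iff₀ h0]
  unfold gibbsMoment
  rw [Finset.mul_sum]
  refine (Finset.abs_sum_le_sum_abs _ _).trans (Finset.sum_le_sum fun i hi => ?_)
  rw [abs_mul, abs_pow, Real.abs_exp, pow_zero, one_mul]
  have := ha i hi
  gcongr

theorem hasDerivAt_gibbsMoment_div (hs : s.Nonempty) (k : ℕ) (t : ℝ) :
    HasDerivAt (fun t => gibbsMoment s c a k t / gibbsMoment s c a 0 t)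
      (gibbsMoment s c a (k + 1) t / gibbsMoment s c a 0 t
        - gibbsMoment s c a k t / gibbsMoment s c a 0 t
          * (gibbsMoment s c a 1 t / gibbsMoment s c a 0 t)) t := by
  have h0 := (gibbsMoment_zero_pos (a := a) c hs t).ne'
  refine ((hasDerivAt_gibbsMoment c k t).fun_div (hasDerivAt_gibbsMoment c 0 t) h0).congr_deriv ?_
  field_simp

/-- Second-order Taylor expansion of the log-partition function in one coupling. The coefficients
are the first two Gibbs cumulants of `a` (the second one halved), and the remainder is controlled
by the third cumulant, which is at most `6 A ^ 3`. -/
theorem exists_taylor_log_sum_exp (hs : s.Nonempty) (ha : ∀ i ∈ s, |a i| ≤ A) :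
    ∃ h₀ h₁ h₂ : ℝ, |h₁| ≤ A ∧ |h₂| ≤ A ^ 2 ∧ ∀ t,
      |Real.log (∑ i ∈ s, Real.exp (c i + t * a i)) - h₀ - h₁ * t - h₂ * t ^ 2|
        ≤ 6 * A ^ 3 * |t| ^ 3 := by
  obtain ⟨i₀, hi₀⟩ := hs
  have hA : 0 ≤ A := (abs_nonneg _).trans (ha i₀ hi₀)
  have hs : s.Nonempty := ⟨i₀, hi₀⟩
  set r : ℕ → ℝ → ℝ := fun k t => gibbsMoment s c a k t / gibbsMoment s c a 0 t with hr
  have hrb : ∀ k t, |r k t| ≤ A ^ k := fun k t => abs_gibbsMoment_div_le c hs ha k t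
  have hrd : ∀ k t, HasDerivAt (r k) (r (k + 1) t - r k t * r 1 t) t :=
    fun k t => hasDerivAt_gibbsMoment_div c hs k t
  have hr1 : ∀ t, |r 1 t| ≤ A := fun t => by simpa using hrb 1 t
  -- the second cumulant varies at rate at most `6 A ^ 3`
  have hκd : ∀ t, HasDerivAt (fun t => r 2 t - r 1 t ^ 2 - (r 2 0 - r 1 0 ^ 2))
      (r 3 t - 3 * (r 2 t * r 1 t) + 2 * r 1 t ^ 3) t := fun t => by
    refine (((hrd 2 t).sub ((hrd 1 t).pow 2)).sub_const (r 2 0 - r 1 0 ^ 2)).congr_deriv ?_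
    simp only [Nat.reduceAdd]
    push_cast
    ring
  have hκb : ∀ t, |r 3 t - 3 * (r 2 t * r 1 t) + 2 * r 1 t ^ 3| ≤ 6 * A ^ 3 * |t| ^ 0 := fun t => by
    have e1 : |r 2 t * r 1 t| ≤ A ^ 2 * A := by
      rw [abs_mul]; exact mul_le_mul (hrb 2 t) (hr1 t) (abs_nonneg _) (by positivity)
    have e2 : |r 1 t ^ 3| ≤ A ^ 3 := by
      rw [abs_pow]; exact pow_le_pow_left₀ (abs_nonneg _) (hr1 t) 3
    have e3 := abs_le.1 (hrb 3 t)
    have e1 := abs_le.1 e1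
    have e2 := abs_le.1 e2
    rw [pow_zero, mul_one, abs_le]
    constructor <;> nlinarith
  have h2 := abs_le_of_abs_hasDerivAt_le (n := 0) (by positivity) hκd (by ring) hκb
  have hmd : ∀ t, HasDerivAt (fun t => r 1 t - r 1 0 - (r 2 0 - r 1 0 ^ 2) * t)
      (r 2 t - r 1 t ^ 2 - (r 2 0 - r 1 0 ^ 2)) t := fun t => by
    refine (((hrd 1 t).sub_const (r 1 0)).sub
      ((hasDerivAt_id t).const_mul (r 2 0 - r 1 0 ^ 2))).congr_deriv ?_
    simp only [Nat.reduceAdd]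
    ring
  have h3 := abs_le_of_abs_hasDerivAt_le (n := 1) (by positivity) hmd (by ring) h2
  have hld : ∀ t, HasDerivAt (fun t => Real.log (gibbsMoment s c a 0 t)
      - Real.log (gibbsMoment s c a 0 0) - r 1 0 * t - (r 2 0 - r 1 0 ^ 2) / 2 * t ^ 2)
      (r 1 t - r 1 0 - (r 2 0 - r 1 0 ^ 2) * t) t := fun t => by
    have h0 := (gibbsMoment_zero_pos (a := a) c hs t).ne'
    refine (((((hasDerivAt_gibbsMoment c 0 t).log h0).sub_const
      (Real.log (gibbsMoment s c a 0 0))).sub ((hasDerivAt_id t).const_mul (r 1 0))).sub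
      (((hasDerivAt_id t).pow 2).const_mul ((r 2 0 - r 1 0 ^ 2) / 2))).congr_deriv ?_
    simp [hr]
    ring
  have h4 := abs_le_of_abs_hasDerivAt_le (n := 2) (by positivity) hld (by ring) h3
  refine ⟨Real.log (gibbsMoment s c a 0 0), r 1 0, (r 2 0 - r 1 0 ^ 2) / 2, hr1 0, ?_, fun t => ?_⟩
  · have e1 := abs_le.1 (hrb 2 0)
    have e2 : r 1 0 ^ 2 ≤ A ^ 2 := by
      rw [← sq_abs]; exact pow_le_pow_left₀ (abs_nonneg _) (hr1 0) 2
    rw [abs_le]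
    constructor <;> nlinarith [sq_nonneg (r 1 0)]
  · simpa [gibbsMoment] using h4 t

theorem abs_log_sum_exp_le (hs : s.Nonempty) {M : ℝ} (hc : ∀ i ∈ s, |c i| ≤ M) :
    |Real.log (∑ i ∈ s, Real.exp (c i))| ≤ Real.log s.card + M := by
  have hcard : (1 : ℝ) ≤ s.card := by exact_mod_cast hs.card_pos
  have hpos : 0 < ∑ i ∈ s, Real.exp (c i) := Finset.sum_pos (fun i _ => Real.exp_pos _) hs
  have hlog : ∀ x : ℝ, Real.log (s.card * Real.exp x) = Real.log s.card + x := fun x => by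
    rw [Real.log_mul (by positivity) (Real.exp_ne_zero _), Real.log_exp]
  have hup : ∑ i ∈ s, Real.exp (c i) ≤ s.card * Real.exp M := by
    rw [← nsmul_eq_mul]
    exact Finset.sum_le_card_nsmul _ _ _ fun i hi => Real.exp_le_exp.2 (abs_le.1 (hc i hi)).2
  have hlo : s.card * Real.exp (-M) ≤ ∑ i ∈ s, Real.exp (c i) := by
    rw [← nsmul_eq_mul]
    exact Finset.card_nsmul_le_sum _ _ _ fun i hi => Real.exp_le_exp.2 (abs_le.1 (hc i hi)).1
  have h1 := Real.log_le_log hpos hup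
  have h2 := Real.log_le_log (by positivity) hlo
  rw [hlog] at h1 h2
  have h3 := Real.log_nonneg hcard
  rw [abs_le]
  constructor <;> linarith

end GibbsMoment

/-! ### Regularity of the free energy in the couplings -/

section FreeEnergy

variable {X : Finset ℝ} {p N : ℕ} {β C : ℝ}

theorem abs_prod_spin_le (hC : ∀ x ∈ X, |x| ≤ C) (e : Edge p N) {S : Fin N → ℝ}
    (hS : S ∈ Fintype.piFinset fun _ : Fin N => X) : |∏ i ∈ e.1, S i| ≤ C ^ p := by
  rw [Finset.abs_prod]
  exact (Finset.prod_le_prod (fun _ _ => abs_nonneg _)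
    fun i _ => hC _ (Fintype.mem_piFinset.1 hS i)).trans (by simp [e.2])

theorem continuous_freeEnergy (hX : X.Nonempty) : Continuous (freeEnergy X β p N) := by
  unfold freeEnergy partitionFunction hamiltonian
  refine continuous_const.mul (Continuous.log (by fun_prop) fun g => ?_)
  exact (Finset.sum_pos (fun i _ => Real.exp_pos _) (Fintype.piFinset_nonempty.2 fun _ => hX)).ne'

theorem exists_abs_freeEnergy_le (hX : X.Nonempty) (hβ : 0 < β) (hC : ∀ x ∈ X, |x| ≤ C) :
    ∃ a A : ℝ, ∀ g, |freeEnergy X β p N g| ≤ a + A * ∑ e, |g e| := by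
  have hS : (Fintype.piFinset fun _ : Fin N => X).Nonempty :=
    Fintype.piFinset_nonempty.2 fun _ => hX
  refine ⟨|-(1 / ((N : ℝ) * β))| * Real.log (Fintype.piFinset fun _ : Fin N => X).card,
    |-(1 / ((N : ℝ) * β))| * (β * C ^ p), fun g => ?_⟩
  rw [freeEnergy, abs_mul, mul_assoc, ← mul_add]
  refine mul_le_mul_of_nonneg_left (abs_log_sum_exp_le _ hS fun S hS => ?_) (abs_nonneg _)
  rw [hamiltonian, neg_mul_neg, abs_mul, abs_of_pos hβ, mul_assoc, Finset.mul_sum]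
  refine mul_le_mul_of_nonneg_left ?_ hβ.le
  refine (Finset.abs_sum_le_sum_abs _ _).trans (Finset.sum_le_sum fun e _ => ?_)
  rw [abs_mul, mul_comm]
  exact mul_le_mul_of_nonneg_right (abs_prod_spin_le hC e hS) (abs_nonneg _)

theorem exists_taylor_freeEnergy (hX : X.Nonempty) (hβ : 0 < β) (hC : ∀ x ∈ X, |x| ≤ C)
    (g : Edge p N → ℝ) (e : Edge p N) :
    ∃ h₀ h₁ h₂ : ℝ, |h₁| ≤ 1 / (N * β) * (β * C ^ p) ∧ |h₂| ≤ 1 / (N * β) * (β * C ^ p) ^ 2 ∧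
      ∀ t, |freeEnergy X β p N (Function.update g e t) - h₀ - h₁ * t - h₂ * t ^ 2|
        ≤ 1 / (N * β) * (6 * (β * C ^ p) ^ 3) * |t| ^ 3 := by
  obtain ⟨h₀, h₁, h₂, b₁, b₂, hT⟩ := exists_taylor_log_sum_exp
    (s := Fintype.piFinset fun _ : Fin N => X) (A := β * C ^ p)
    (fun S => β * ∑ e' ∈ Finset.univ.erase e, g e' * ∏ i ∈ e'.1, S i)
    (a := fun S => β * ∏ i ∈ e.1, S i)
    (Fintype.piFinset_nonempty.2 fun _ => hX) (fun S hS => by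
      rw [abs_mul, abs_of_pos hβ]
      exact mul_le_mul_of_nonneg_left (abs_prod_spin_le hC e hS) hβ.le)
  have hk : 0 ≤ 1 / ((N : ℝ) * β) := by positivity
  set k := 1 / ((N : ℝ) * β) with hkdef
  refine ⟨-k * h₀, -k * h₁, -k * h₂, ?_, ?_, fun t => ?_⟩
  · rw [abs_mul, abs_neg, abs_of_nonneg hk]
    gcongr
  · rw [abs_mul, abs_neg, abs_of_nonneg hk]
    gcongr
  · have hZ : partitionFunction X β p N (Function.update g e t)
        = ∑ S ∈ Fintype.piFinset fun _ : Fin N => X,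
          Real.exp (β * ∑ e' ∈ Finset.univ.erase e, g e' * ∏ i ∈ e'.1, S i
            + t * (β * ∏ i ∈ e.1, S i)) := by
      refine Finset.sum_congr rfl fun S _ => ?_
      rw [hamiltonian, neg_mul_neg, ← Finset.add_sum_erase _ _ (Finset.mem_univ e),
        Function.update_self]
      congr 1
      rw [Finset.sum_congr rfl fun e' he' => by
        rw [Function.update_of_ne (Finset.ne_of_mem_erase he')]]
      ring
    rw [freeEnergy, hZ, ← hkdef]
    rw [mul_assoc, ← mul_sub, mul_assoc, ← mul_sub, mul_assoc, ← mul_sub, abs_mul, abs_neg,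
      abs_of_nonneg hk]
    exact mul_le_mul_of_nonneg_left (hT t) hk

end FreeEnergy

/-! ### Replacing the coordinates of a product measure one at a time -/

section Lindeberg

/-- Resampling coordinate `i` of a product measure from `μ` replaces its `i`-th factor by `μ`. -/
theorem map_update_pi_prod {ι : Type*} [Fintype ι] [DecidableEq ι] (m : ι → Measure ℝ)
    [∀ i, IsProbabilityMeasure (m i)] (i : ι) (μ : Measure ℝ) [IsProbabilityMeasure μ] :
    ((Measure.pi m).prod μ).map (fun q : (ι → ℝ) × ℝ => Function.update q.1 i q.2)
      = Measure.pi (Function.update m i μ) := by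
  have hprob : ∀ j, IsProbabilityMeasure (Function.update m i μ j) := fun j => by
    by_cases h : j = i
    · subst h; simpa using ‹IsProbabilityMeasure μ›
    · simpa [Function.update_of_ne h] using inferInstanceAs (IsProbabilityMeasure (m j))
  refine (Measure.pi_eq fun s hs => ?_).symm
  have hmeas : Measurable fun q : (ι → ℝ) × ℝ => Function.update q.1 i q.2 := by
    fun_prop
  have hpre : (fun q : (ι → ℝ) × ℝ => Function.update q.1 i q.2) ⁻¹' Set.univ.pi s
      = Set.univ.pi (Function.update s i Set.univ) ×ˢ s i := by
    ext ⟨g, t⟩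
    simp only [Set.mem_preimage, Set.mem_univ_pi, Set.mem_prod]
    constructor
    · refine fun h => ⟨fun j => ?_, by simpa using h i⟩
      by_cases hj : j = i
      · subst hj; simp
      · simpa [Function.update_of_ne hj] using h j
    · rintro ⟨h, ht⟩ j
      by_cases hj : j = i
      · subst hj; simpa using ht
      · simpa [Function.update_of_ne hj] using h j
  rw [Measure.map_apply hmeas (MeasurableSet.univ_pi hs), hpre, Measure.prod_prod, Measure.pi_pi,
    ← Finset.mul_prod_erase _ _ (Finset.mem_univ i),
    ← Finset.mul_prod_erase _ _ (Finset.mem_univ i)]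
  simp only [Function.update_self, measure_univ, one_mul]
  rw [mul_comm]
  congr 1
  refine Finset.prod_congr rfl fun j hj => ?_
  rw [Function.update_of_ne (Finset.ne_of_mem_erase hj),
    Function.update_of_ne (Finset.ne_of_mem_erase hj)]

theorem integrable_pow_of_integrable_abs_pow_three {μ : Measure ℝ} [IsFiniteMeasure μ]
    (hμ : Integrable (fun t : ℝ => |t| ^ 3) μ) {k : ℕ} (hk : k ≤ 3) :
    Integrable (fun t : ℝ => t ^ k) μ := by
  refine Integrable.mono' ((integrable_const 1).add hμ) (by fun_prop) (ae_of_all _ fun t => ?_)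
  rw [Real.norm_eq_abs, abs_pow]
  simp only [Pi.add_apply]
  rcases le_total |t| 1 with h | h
  · exact (pow_le_one₀ (abs_nonneg t) h).trans (le_add_of_nonneg_right (by positivity))
  · exact (pow_le_pow_right₀ h hk).trans (le_add_of_nonneg_left zero_le_one)

/-- Two laws with nearly equal first two moments and small third absolute moments give nearly the
same integral to a function with a second-order Taylor expansion. -/
theorem abs_integral_sub_integral_le_of_taylor {h : ℝ → ℝ} (hh : Continuous h)
    {h₀ h₁ h₂ A₁ A₂ A₃ : ℝ} (b₁ : |h₁| ≤ A₁) (b₂ : |h₂| ≤ A₂)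
    (hT : ∀ t, |h t - h₀ - h₁ * t - h₂ * t ^ 2| ≤ A₃ * |t| ^ 3)
    {μ ν : Measure ℝ} [IsProbabilityMeasure μ] [IsProbabilityMeasure ν]
    (hμ : Integrable (fun t : ℝ => |t| ^ 3) μ) (hν : Integrable (fun t : ℝ => |t| ^ 3) ν) :
    |∫ t, h t ∂μ - ∫ t, h t ∂ν| ≤ A₁ * |∫ t, t ∂μ - ∫ t, t ∂ν|
      + A₂ * |∫ t, t ^ 2 ∂μ - ∫ t, t ^ 2 ∂ν|
      + A₃ * (∫ t, |t| ^ 3 ∂μ + ∫ t, |t| ^ 3 ∂ν) := by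
  have hT' : ∀ t, |h t - (h₀ + h₁ * t + h₂ * t ^ 2)| ≤ A₃ * |t| ^ 3 := fun t => by
    rw [← sub_sub, ← sub_sub]; exact hT t
  have key : ∀ (ρ : Measure ℝ) [IsProbabilityMeasure ρ], Integrable (fun t : ℝ => |t| ^ 3) ρ →
      |∫ t, h t ∂ρ - (h₀ + h₁ * ∫ t, t ∂ρ + h₂ * ∫ t, t ^ 2 ∂ρ)| ≤ A₃ * ∫ t, |t| ^ 3 ∂ρ := by
    intro ρ _ hρ
    have i1 : Integrable (fun t : ℝ => t) ρ := by
      simpa using integrable_pow_of_integrable_abs_pow_three hρ (k := 1) (by norm_num)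
    have i2 : Integrable (fun t : ℝ => t ^ 2) ρ :=
      integrable_pow_of_integrable_abs_pow_three hρ (by norm_num)
    have iP : Integrable (fun t : ℝ => h₀ + h₁ * t + h₂ * t ^ 2) ρ :=
      ((integrable_const h₀).add (i1.const_mul h₁)).add (i2.const_mul h₂)
    have iR : Integrable (fun t : ℝ => h t - (h₀ + h₁ * t + h₂ * t ^ 2)) ρ :=
      Integrable.mono' (hρ.const_mul A₃) (by fun_prop) (ae_of_all _ hT')
    have ih : Integrable h ρ := (iR.add iP).congr (ae_of_all _ fun t => by simp)
    have eP : ∫ t, (h₀ + h₁ * t + h₂ * t ^ 2) ∂ρ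
        = h₀ + h₁ * ∫ t, t ∂ρ + h₂ * ∫ t, t ^ 2 ∂ρ := by
      rw [integral_add (f := fun t => h₀ + h₁ * t)
        ((integrable_const h₀).add (i1.const_mul h₁)) (i2.const_mul h₂), integral_add (integrable_const h₀) (i1.const_mul h₁), integral_const_mul,
        integral_const_mul]
      simp
    rw [← eP, ← integral_sub ih iP, ← integral_const_mul]
    exact abs_integral_le_integral_abs.trans (integral_mono iR.abs (hρ.const_mul A₃) hT')
  have e1 := abs_le.1 (key μ hμ)
  have e2 := abs_le.1 (key ν hν)
  have e3 : |h₁ * (∫ t, t ∂μ - ∫ t, t ∂ν)| ≤ A₁ * |∫ t, t ∂μ - ∫ t, t ∂ν| := by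
    rw [abs_mul]; gcongr
  have e4 : |h₂ * (∫ t, t ^ 2 ∂μ - ∫ t, t ^ 2 ∂ν)|
      ≤ A₂ * |∫ t, t ^ 2 ∂μ - ∫ t, t ^ 2 ∂ν| := by
    rw [abs_mul]; gcongr
  have e3 := abs_le.1 e3
  have e4 := abs_le.1 e4
  rw [abs_le]
  constructor <;> linarith

variable {ι : Type*} [Fintype ι] {F : (ι → ℝ) → ℝ}

theorem integrable_pi_of_abs_le (hF : Continuous F) {a A : ℝ}
    (hgrow : ∀ g, |F g| ≤ a + A * ∑ i, |g i|) (m : ι → Measure ℝ)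
    [∀ i, IsProbabilityMeasure (m i)] (hm : ∀ i, Integrable (fun t : ℝ => |t| ^ 3) (m i)) :
    Integrable F (Measure.pi m) := by
  refine Integrable.mono' ((integrable_const a).add ((integrable_finsetSum Finset.univ
    fun i _ => ?_).const_mul A)) hF.aestronglyMeasurable (ae_of_all _ hgrow)
  have h1 : Integrable (fun t : ℝ => |t|) (m i) := by
    simpa using (integrable_pow_of_integrable_abs_pow_three (hm i) (k := 1) (by norm_num)).abs
  exact (measurePreserving_eval m i).integrable_comp_of_integrable h1

/-- **Lindeberg's replacement bound.** Passing from i.i.d. coordinates of law `ν` to i.i.d.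
coordinates of law `μ` one coordinate at a time, each step costs at most the Taylor bound in that
coordinate, the other coordinates being frozen. -/
theorem abs_integral_pi_sub_integral_pi_le [DecidableEq ι] (hF : Continuous F) {a A : ℝ}
    (hgrow : ∀ g, |F g| ≤ a + A * ∑ i, |g i|) {A₁ A₂ A₃ : ℝ}
    (hT : ∀ g i, ∃ h₀ h₁ h₂ : ℝ, |h₁| ≤ A₁ ∧ |h₂| ≤ A₂ ∧
      ∀ t, |F (Function.update g i t) - h₀ - h₁ * t - h₂ * t ^ 2| ≤ A₃ * |t| ^ 3)
    {μ ν : Measure ℝ} [IsProbabilityMeasure μ] [IsProbabilityMeasure ν]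
    (hμ : Integrable (fun t : ℝ => |t| ^ 3) μ) (hν : Integrable (fun t : ℝ => |t| ^ 3) ν) :
    |∫ g, F g ∂(Measure.pi fun _ : ι => μ) - ∫ g, F g ∂(Measure.pi fun _ : ι => ν)|
      ≤ Fintype.card ι * (A₁ * |∫ t, t ∂μ - ∫ t, t ∂ν|
        + A₂ * |∫ t, t ^ 2 ∂μ - ∫ t, t ^ 2 ∂ν|
        + A₃ * (∫ t, |t| ^ 3 ∂μ + ∫ t, |t| ^ 3 ∂ν)) := by
  set δ := A₁ * |∫ t, t ∂μ - ∫ t, t ∂ν| + A₂ * |∫ t, t ^ 2 ∂μ - ∫ t, t ^ 2 ∂ν|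
        + A₃ * (∫ t, |t| ^ 3 ∂μ + ∫ t, |t| ^ 3 ∂ν)
  -- the hybrid family, of law `μ` on `s` and `ν` off `s`
  let m : Finset ι → ι → Measure ℝ := fun s i => if i ∈ s then μ else ν
  have hmp : ∀ s i, IsProbabilityMeasure (m s i) := fun s i => by
    simp only [m]; split_ifs <;> infer_instance
  have hmi : ∀ s i, Integrable (fun t : ℝ => |t| ^ 3) (m s i) := fun s i => by
    simp only [m]; split_ifs <;> assumption
  have hins : ∀ s i, m (insert i s) = Function.update (m s) i μ := fun s i => by
    ext1 j
    by_cases h : j = i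
    · subst h; simp [m]
    · simp [m, h]
  have hself : ∀ s i, i ∉ s → m s = Function.update (m s) i ν := fun s i hi => by
    ext1 j
    by_cases h : j = i
    · subst h; simp [m, hi]
    · simp [m, h]
  have hupd : ∀ i, Measurable fun q : (ι → ℝ) × ℝ => Function.update q.1 i q.2 := by
    intro i; fun_prop
  have hfub : ∀ s s' i (ρ : Measure ℝ) [IsProbabilityMeasure ρ],
      m s' = Function.update (m s) i ρ →
      Integrable (fun g => ∫ t, F (Function.update g i t) ∂ρ) (Measure.pi (m s)) ∧
      ∫ g, F g ∂(Measure.pi (m s'))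
        = ∫ g, ∫ t, F (Function.update g i t) ∂ρ ∂(Measure.pi (m s)) := by
    intro s s' i ρ _ hs'
    have hint := integrable_pi_of_abs_le hF hgrow (m s') (hmi s')
    rw [hs', ← map_update_pi_prod (m s) i ρ] at hint ⊢
    have hint' := (integrable_map_measure hF.aestronglyMeasurable (hupd i).aemeasurable).1 hint
    exact ⟨hint'.integral_prod_left, by
      rw [integral_map (hupd i).aemeasurable hF.aestronglyMeasurable]
      exact integral_prod _ hint'⟩
  have main : ∀ s : Finset ι, |∫ g, F g ∂(Measure.pi (m s)) - ∫ g, F g ∂(Measure.pi (m ∅))|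
      ≤ s.card * δ := by
    intro s
    induction s using Finset.induction_on with
    | empty => simp
    | insert i s hi ih =>
      obtain ⟨i1, e1⟩ := hfub s (insert i s) i μ (hins s i)
      obtain ⟨i2, e2⟩ := hfub s s i ν (hself s i hi)
      have step : |∫ g, F g ∂(Measure.pi (m (insert i s))) - ∫ g, F g ∂(Measure.pi (m s))|
          ≤ δ := by
        rw [e1, e2, ← integral_sub i1 i2, ← Real.norm_eq_abs]
        refine (norm_integral_le_of_norm_le_const (C := δ) (ae_of_all _ fun g => ?_)).trans
          (by simp)
        obtain ⟨h₀, h₁, h₂, b₁, b₂, hT'⟩ := hT g i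
        exact abs_integral_sub_integral_le_of_taylor
          (hF.comp (continuous_const.update i continuous_id)) b₁ b₂ hT' hμ hν
      rw [Finset.card_insert_of_notMem hi]
      push_cast
      have := abs_sub_le (∫ g, F g ∂(Measure.pi (m (insert i s))))
        (∫ g, F g ∂(Measure.pi (m s))) (∫ g, F g ∂(Measure.pi (m ∅)))
      linarith
  simpa [m] using main Finset.univ

end Lindeberg

/-! ### Universality of the quenched free energy -/

theorem card_edge_le (p N : ℕ) : Fintype.card (Edge p N) ≤ N ^ p := by
  rw [Fintype.card_finset_len, Fintype.card_fin]
  exact Nat.choose_le_pow N p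

/-- Two families of i.i.d. couplings give asymptotically equal quenched free energies as soon as
their first two moments agree up to `o (N ^ (1 - p))` and their third absolute moments are
`o (N ^ (1 - p))`: there are at most `N ^ p` couplings, each of which moves the free energy per
site by a quantity of order `1 / N`. -/
theorem tendsto_integral_freeEnergy_sub {X : Finset ℝ} (hX : X.Nonempty) {p : ℕ} (hp : 1 ≤ p)
    {β : ℝ} (hβ : 0 < β) {μ ν : ℕ → Measure ℝ}
    (hμp : ∀ N, IsProbabilityMeasure (μ N)) (hνp : ∀ N, IsProbabilityMeasure (ν N))
    (hμ : ∀ N, Integrable (fun t : ℝ => |t| ^ 3) (μ N))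
    (hν : ∀ N, Integrable (fun t : ℝ => |t| ^ 3) (ν N))
    (h₁ : Tendsto (fun N : ℕ => (N : ℝ) ^ (p - 1) * |∫ t, t ∂(μ N) - ∫ t, t ∂(ν N)|) atTop (𝓝 0))
    (h₂ : Tendsto (fun N : ℕ => (N : ℝ) ^ (p - 1) * |∫ t, t ^ 2 ∂(μ N) - ∫ t, t ^ 2 ∂(ν N)|)
      atTop (𝓝 0))
    (hμ₃ : Tendsto (fun N : ℕ => (N : ℝ) ^ (p - 1) * ∫ t, |t| ^ 3 ∂(μ N)) atTop (𝓝 0))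
    (hν₃ : Tendsto (fun N : ℕ => (N : ℝ) ^ (p - 1) * ∫ t, |t| ^ 3 ∂(ν N)) atTop (𝓝 0)) :
    Tendsto (fun N => ∫ g, freeEnergy X β p N g ∂(Measure.pi fun _ => μ N)
      - ∫ g, freeEnergy X β p N g ∂(Measure.pi fun _ => ν N)) atTop (𝓝 0) := by
  obtain ⟨C, hC⟩ : ∃ C, ∀ x ∈ X, |x| ≤ C :=
    ⟨∑ x ∈ X, |x|, fun x hx => Finset.single_le_sum (f := fun x => |x|)
      (fun _ _ => abs_nonneg _) hx⟩
  have hC0 : 0 ≤ C := by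
    obtain ⟨x, hx⟩ := hX
    exact (abs_nonneg x).trans (hC x hx)
  set A := β * C ^ p
  have hA0 : 0 ≤ A := by positivity
  have hlim := (((h₁.const_mul A).add (h₂.const_mul (A ^ 2))).add
    ((hμ₃.add hν₃).const_mul (6 * A ^ 3))).const_mul (1 / β)
  simp only [mul_zero, add_zero] at hlim
  refine squeeze_zero_norm' ?_ hlim
  filter_upwards [eventually_ge_atTop 1] with N hN
  have := hμp N
  have := hνp N
  obtain ⟨a, A', hgrow⟩ := exists_abs_freeEnergy_le (p := p) (N := N) hX hβ hC
  have hmain := abs_integral_pi_sub_integral_pi_le (continuous_freeEnergy hX) hgrow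
    (exists_taylor_freeEnergy hX hβ hC) (hμ N) (hν N)
  rw [Real.norm_eq_abs]
  refine hmain.trans ?_
  have hN0 : (0 : ℝ) < N := by exact_mod_cast hN
  have hcard : (Fintype.card (Edge p N) : ℝ) * (1 / (N * β)) ≤ 1 / β * (N : ℝ) ^ (p - 1) := by
    have h1 : (Fintype.card (Edge p N) : ℝ) ≤ (N : ℝ) ^ (p - 1) * N := by
      rw [← pow_succ, Nat.sub_add_cancel hp]
      exact_mod_cast card_edge_le p N
    rw [mul_one_div, one_div_mul_eq_div, div_le_div_iff₀ (by positivity) hβ]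
    nlinarith
  have h3μ : 0 ≤ ∫ t, |t| ^ 3 ∂(μ N) := integral_nonneg fun t => by positivity
  have h3ν : 0 ≤ ∫ t, |t| ^ 3 ∂(ν N) := integral_nonneg fun t => by positivity
  have hδ : 0 ≤ A * |∫ t, t ∂(μ N) - ∫ t, t ∂(ν N)|
      + A ^ 2 * |∫ t, t ^ 2 ∂(μ N) - ∫ t, t ^ 2 ∂(ν N)|
      + 6 * A ^ 3 * (∫ t, |t| ^ 3 ∂(μ N) + ∫ t, |t| ^ 3 ∂(ν N)) := by positivity
  refine le_trans (le_of_eq ?_) ((mul_le_mul_of_nonneg_right hcard hδ).trans (le_of_eq ?_)) <;> ring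

/-! ### The dilution scale -/

section Scale

variable {α b : ℝ} {p N : ℕ}

theorem bondProb_eq_scale_div (hp : 1 ≤ p) (hN : 1 ≤ N) :
    bondProb α b p N = scale α b p N / (N : ℝ) ^ (p - 1) := by
  have hN' : (0 : ℝ) < N := by exact_mod_cast hN
  rw [bondProb, scale, sub_mul, one_mul, Real.rpow_sub hN', mul_div_assoc]
  congr 2
  rw [← Real.rpow_natCast, Nat.cast_sub hp, Nat.cast_one]

theorem scale_le_pow (hα : α ∈ Set.Ioc (0 : ℝ) 1) (hb : b ∈ Set.Ioc (0 : ℝ) 1) (hp : 1 ≤ p)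
    (hN : 1 ≤ N) : scale α b p N ≤ (N : ℝ) ^ (p - 1) := by
  have h := (bondProb_mem_unitInterval hα hb hp hN).2
  have hN' : (0 : ℝ) < N := by exact_mod_cast hN
  rwa [bondProb_eq_scale_div hp hN, div_le_one (by positivity)] at h

/-- Moments of a dilution variable: it contributes `bondProb` to every function normalized by
`f 0 = 0` and `f 1 = 1`. -/
theorem integral_bondLaw (hα : α ∈ Set.Ioc (0 : ℝ) 1) (hb : b ∈ Set.Ioc (0 : ℝ) 1) (hp : 1 ≤ p)
    (hN : 1 ≤ N) {f : ℝ → ℝ} (h0 : f 0 = 0) (h1 : f 1 = 1) :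
    ∫ k, f k ∂(bondLaw α b p N) = scale α b p N / (N : ℝ) ^ (p - 1) := by
  rw [← bondProb_eq_scale_div hp hN, bondLaw, integral_bernoulliMeasure, h0, h1,
    Set.projIcc_of_mem _ (bondProb_mem_unitInterval hα hb hp hN)]
  simp

instance : IsProbabilityMeasure (bondLaw α b p N) := by
  unfold bondLaw; infer_instance

theorem integrable_bondLaw (f : ℝ → ℝ) : Integrable f (bondLaw α b p N) :=
  integrable_bernoulliMeasure _ _ _ f

end Scale

/-! ### The laws of the couplings -/

section Laws

theorem integral_pi_map {ι E : Type*} [Fintype ι] [MeasurableSpace E] (ρ : Measure E)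
    [IsProbabilityMeasure ρ] {φ : E → ℝ} (hφ : Measurable φ) {F : (ι → ℝ) → ℝ}
    (hF : Continuous F) :
    ∫ g, F g ∂(Measure.pi fun _ : ι => ρ.map φ) = ∫ g, F (fun i => φ (g i)) ∂(Measure.pi fun _ => ρ)
    := by
  have := Measure.isProbabilityMeasure_map (μ := ρ) hφ.aemeasurable
  rw [← Measure.pi_map_pi (μ := fun _ : ι => ρ) (f := fun _ => φ) fun _ => hφ.aemeasurable,
    integral_map (φ := fun g : ι → E => fun i => φ (g i))
      (measurable_pi_lambda _ fun i => hφ.comp (measurable_pi_apply i)).aemeasurable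
      hF.aestronglyMeasurable]

/-- The law of the coupling `s K J` with `K` a dilution variable and `J` of law `ν`. -/
noncomputable def dilutedCouplingLaw (α b : ℝ) (p N : ℕ) (s : ℝ) (ν : Measure ℝ) : Measure ℝ :=
  ((bondLaw α b p N).prod ν).map fun q => s * (q.1 * q.2)

variable {α b s : ℝ} {p N : ℕ} {ν : Measure ℝ}

theorem integrable_dilutedCouplingLaw (hν : Integrable (fun t : ℝ => |t| ^ 3) ν) :
    Integrable (fun t : ℝ => |t| ^ 3) (dilutedCouplingLaw α b p N s ν) := by
  rw [dilutedCouplingLaw, integrable_map_measure (by fun_prop) (by fun_prop)]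
  have h : Integrable (fun q : ℝ × ℝ => |s| ^ 3 * (|q.1| ^ 3 * |q.2| ^ 3))
      ((bondLaw α b p N).prod ν) :=
    ((integrable_bondLaw fun t : ℝ => |t| ^ 3).mul_prod hν).const_mul _
  refine h.congr (ae_of_all _ fun q => ?_)
  simp [abs_mul, mul_pow]

variable [IsProbabilityMeasure ν]

instance : IsProbabilityMeasure (dilutedCouplingLaw α b p N s ν) :=
  Measure.isProbabilityMeasure_map (by fun_prop)

theorem integral_dilutedCouplingLaw (hα : α ∈ Set.Ioc (0 : ℝ) 1) (hb : b ∈ Set.Ioc (0 : ℝ) 1)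
    (hp : 1 ≤ p) (hN : 1 ≤ N) {f : ℝ → ℝ} (hf : Continuous f) (hmul : ∀ x y, f (x * y) = f x * f y)
    (h0 : f 0 = 0) (h1 : f 1 = 1) :
    ∫ t, f t ∂(dilutedCouplingLaw α b p N s ν)
      = f s * (scale α b p N / (N : ℝ) ^ (p - 1) * ∫ t, f t ∂ν) := by
  rw [dilutedCouplingLaw, integral_map (by fun_prop) hf.aestronglyMeasurable]
  simp only [hmul]
  rw [integral_const_mul, integral_prod_mul f f, integral_bondLaw hα hb hp hN h0 h1]

theorem quenchedDilutedGlass_eq {X : Finset ℝ} (hX : X.Nonempty) (β : ℝ) :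
    quenchedDilutedGlass X β p α b ν N = ∫ g, freeEnergy X β p N g ∂(Measure.pi fun _ =>
      dilutedCouplingLaw α b p N √((p.factorial : ℝ) / (2 * scale α b p N)) ν) := by
  unfold dilutedCouplingLaw
  rw [integral_pi_map _ (by fun_prop) (continuous_freeEnergy hX), quenchedDilutedGlass, dilutionLaw,
    ← (measurePreserving_arrowProdEquivProdArrow ℝ ℝ (Edge p N) (fun _ => bondLaw α b p N)
      fun _ => ν).integral_comp (MeasurableEquiv.measurableEmbedding _)]
  rfl

theorem quenchedDilutedFerro_eq {X : Finset ℝ} (hX : X.Nonempty) (β : ℝ) :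
    quenchedDilutedFerro X β p α b N = ∫ g, freeEnergy X β p N g ∂(Measure.pi fun _ =>
      (bondLaw α b p N).map fun k => (p.factorial : ℝ) / (2 * scale α b p N) * k) := by
  rw [integral_pi_map _ (by fun_prop) (continuous_freeEnergy hX), quenchedDilutedFerro, dilutionLaw]

theorem meanFieldFerro_eq {X : Finset ℝ} (hX : X.Nonempty) (β : ℝ) :
    meanFieldFerro X β p N = ∫ g, freeEnergy X β p N g ∂(Measure.pi fun _ =>
      Measure.dirac ((p.factorial : ℝ) / (2 * (N : ℝ) ^ (p - 1)))) := by
  -- a point mass is the law of a constant function on a one-point probability space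
  have h := integral_pi_map (ι := Edge p N) (Measure.dirac ()) (measurable_const
    (a := (p.factorial : ℝ) / (2 * (N : ℝ) ^ (p - 1)))) (continuous_freeEnergy (β := β) hX)
  rw [Measure.map_dirac' measurable_const] at h
  rw [h]
  simp [meanFieldFerro]

theorem quenchedMeanFieldGlass_eq {X : Finset ℝ} (hX : X.Nonempty) (β J₀ J : ℝ) :
    quenchedMeanFieldGlass X β p J₀ J N = ∫ g, freeEnergy X β p N g ∂(Measure.pi fun _ =>
      (gaussianReal (J₀ * √((p.factorial : ℝ) / (2 * (N : ℝ) ^ (p - 1))))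
        (Real.toNNReal (J ^ 2))).map
          fun t => √((p.factorial : ℝ) / (2 * (N : ℝ) ^ (p - 1))) * t) := by
  rw [integral_pi_map _ (by fun_prop) (continuous_freeEnergy hX), quenchedMeanFieldGlass]

end Laws

/-! ### Moments of Gaussian couplings -/

section Gaussian

open scoped NNReal

theorem integrable_abs_pow_three_gaussianReal (m : ℝ) (v : ℝ≥0) :
    Integrable (fun t : ℝ => |t| ^ 3) (gaussianReal m v) := by
  simpa using (memLp_id_gaussianReal (μ := m) (v := v) 3).integrable_norm_pow (by norm_num)

theorem integral_sq_gaussianReal (m : ℝ) (v : ℝ≥0) :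
    ∫ t, t ^ 2 ∂(gaussianReal m v) = v + m ^ 2 := by
  have h := variance_eq_sub (memLp_id_gaussianReal (μ := m) (v := v) 2)
  rw [variance_id_gaussianReal] at h
  simp only [Pi.pow_apply, id_eq, integral_id_gaussianReal] at h
  linarith

theorem integral_abs_pow_three_gaussianReal_le (m : ℝ) (v : ℝ≥0) :
    ∫ t, |t| ^ 3 ∂(gaussianReal m v) ≤ 4 * (∫ t, |t| ^ 3 ∂(gaussianReal 0 v) + |m| ^ 3) := by
  have hi := integrable_abs_pow_three_gaussianReal 0 v
  have hm := integrable_abs_pow_three_gaussianReal m v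
  have e : gaussianReal m v = (gaussianReal 0 v).map (· + m) := by
    rw [gaussianReal_map_add_const, zero_add]
  rw [e, integrable_map_measure (by fun_prop) (by fun_prop)] at hm
  rw [e, integral_map (by fun_prop) (by fun_prop)]
  calc ∫ t, |t + m| ^ 3 ∂(gaussianReal 0 v)
      ≤ ∫ t, 4 * (|t| ^ 3 + |m| ^ 3) ∂(gaussianReal 0 v) := by
        refine integral_mono hm ((hi.add (integrable_const _)).const_mul 4) fun t => ?_
        refine (pow_le_pow_left₀ (abs_nonneg _) (abs_add_le t m) 3).trans ?_
        refine (add_pow_le (abs_nonneg t) (abs_nonneg m) 3).trans (by norm_num)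
    _ = _ := by
        rw [integral_const_mul, integral_add hi (integrable_const _)]
        simp

end Gaussian

/-! ### Comparison of the diluted and the mean-field models -/

section Comparison

variable {X : Finset ℝ} {p : ℕ} {β J₀ J : ℝ} {α b : ℕ → ℝ}

theorem tendsto_pow_atTop_of_scale (hp : 1 ≤ p)
    (hα : ∀ N, α N ∈ Set.Ioc (0 : ℝ) 1) (hb : ∀ N, b N ∈ Set.Ioc (0 : ℝ) 1)
    (hαb : Tendsto (fun N => scale (α N) (b N) p N) atTop atTop) :
    Tendsto (fun N : ℕ => (N : ℝ) ^ (p - 1)) atTop atTop :=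
  tendsto_atTop_mono' _ ((eventually_ge_atTop 1).mono fun N hN =>
    scale_le_pow (hα N) (hb N) hp hN) hαb

theorem tendsto_factorial_div_scale (hαb : Tendsto (fun N => scale (α N) (b N) p N) atTop atTop) :
    Tendsto (fun N => (p.factorial : ℝ) / (2 * scale (α N) (b N) p N)) atTop (𝓝 0) :=
  tendsto_const_nhds.div_atTop (hαb.const_mul_atTop two_pos)

theorem mul_abs_eq_mul_abs {c d u v : ℝ} (hc : 0 ≤ c) (hd : 0 ≤ d) (h : c * u = d * v) :
    c * |u| = d * |v| := by
  simpa only [abs_mul, abs_of_nonneg hc, abs_of_nonneg hd] using congrArg abs h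

theorem tendsto_quenchedDilutedFerro_sub (hX : X.Nonempty) (hp : 1 ≤ p) (hβ : 0 < β)
    (hα : ∀ N, α N ∈ Set.Ioc (0 : ℝ) 1) (hb : ∀ N, b N ∈ Set.Ioc (0 : ℝ) 1)
    (hαb : Tendsto (fun N => scale (α N) (b N) p N) atTop atTop) :
    Tendsto (fun N => quenchedDilutedFerro X β p (α N) (b N) N - meanFieldFerro X β p N)
      atTop (𝓝 0) := by
  simp only [quenchedDilutedFerro_eq hX, meanFieldFerro_eq hX]
  have hpow := tendsto_pow_atTop_of_scale hp hα hb hαb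
  have hc := tendsto_factorial_div_scale hαb
  have hd : Tendsto (fun N : ℕ => (p.factorial : ℝ) / (2 * (N : ℝ) ^ (p - 1))) atTop (𝓝 0) :=
    tendsto_const_nhds.div_atTop (hpow.const_mul_atTop two_pos)
  have hmom : ∀ {f : ℝ → ℝ}, Continuous f → (∀ x y, f (x * y) = f x * f y) → f 0 = 0 → f 1 = 1 →
      ∀ c : ℝ, ∀ N, 1 ≤ N → ∫ t, f t ∂((bondLaw (α N) (b N) p N).map fun k => c * k)
        = f c * (scale (α N) (b N) p N / (N : ℝ) ^ (p - 1)) := by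
    intro f hf hmul h0 h1 c N hN
    rw [integral_map (by fun_prop) hf.aestronglyMeasurable]
    simp only [hmul]
    rw [integral_const_mul, integral_bondLaw (hα N) (hb N) hp hN h0 h1]
  have hev := (eventually_ge_atTop 1).and (hαb.eventually_gt_atTop 0)
  refine tendsto_integral_freeEnergy_sub hX hp hβ
    (fun N => Measure.isProbabilityMeasure_map (by fun_prop)) (fun N => inferInstance)
    (fun N => ?_) (fun N => integrable_dirac (by simp)) ?_ ?_ ?_ ?_
  · rw [integrable_map_measure (by fun_prop) (by fun_prop)]
    exact integrable_bondLaw _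
  · refine tendsto_const_nhds.congr' ?_
    filter_upwards [hev] with N hN
    have hN0 : (0 : ℝ) < N := by exact_mod_cast hN.1
    have hx := hN.2
    rw [hmom (f := fun t => t) (by fun_prop) (by simp) rfl rfl _ N hN.1, integral_dirac]
    field_simp
    simp
  · have h : Tendsto (fun N : ℕ => (p.factorial : ℝ) / 2
        * |(p.factorial : ℝ) / (2 * scale (α N) (b N) p N)
          - (p.factorial : ℝ) / (2 * (N : ℝ) ^ (p - 1))|) atTop (𝓝 0) := by
      simpa using ((hc.sub hd).abs).const_mul ((p.factorial : ℝ) / 2)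
    refine h.congr' ?_
    filter_upwards [hev] with N hN
    have hN0 : (0 : ℝ) < N := by exact_mod_cast hN.1
    have hx := hN.2
    rw [hmom (f := fun t => t ^ 2) (by fun_prop) (fun x y => mul_pow x y 2) (by simp) (by simp) _ N
      hN.1, integral_dirac]
    refine mul_abs_eq_mul_abs (by positivity) (by positivity) ?_
    field_simp
  · have h := (hc.pow 2).const_mul ((p.factorial : ℝ) / 2)
    rw [zero_pow two_ne_zero, mul_zero] at h
    refine h.congr' ?_
    filter_upwards [hev] with N hN
    have hN0 : (0 : ℝ) < N := by exact_mod_cast hN.1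
    have hx := hN.2
    rw [hmom (f := fun t => |t| ^ 3) (by fun_prop) (fun x y => by rw [abs_mul, mul_pow]) (by simp)
      (by simp) _ N hN.1, abs_of_pos (by positivity)]
    field_simp
  · have h := (hd.pow 2).const_mul ((p.factorial : ℝ) / 2)
    rw [zero_pow two_ne_zero, mul_zero] at h
    refine h.congr' ?_
    filter_upwards [hev] with N hN
    have hN0 : (0 : ℝ) < N := by exact_mod_cast hN.1
    rw [integral_dirac, abs_of_pos (by positivity)]
    field_simp

/-- Only three features of the law of the couplings of the diluted spin glass matter: its mean,
with precision `o (x ^ (-1/2))` at dilution scale `x`, the limit of its second moment, and a bound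
on its third absolute moment. -/
theorem tendsto_quenchedDilutedGlass_sub (hX : X.Nonempty) (hp : 1 ≤ p) (hβ : 0 < β)
    (hα : ∀ N, α N ∈ Set.Ioc (0 : ℝ) 1) (hb : ∀ N, b N ∈ Set.Ioc (0 : ℝ) 1)
    (hαb : Tendsto (fun N => scale (α N) (b N) p N) atTop atTop) {ν : ℕ → Measure ℝ}
    (hνp : ∀ N, IsProbabilityMeasure (ν N)) (hν : ∀ N, Integrable (fun t : ℝ => |t| ^ 3) (ν N))
    (hmean : Tendsto (fun N => √(scale (α N) (b N) p N) * ((∫ t, t ∂(ν N))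
      - J₀ * √((p.factorial : ℝ) / (2 * scale (α N) (b N) p N)))) atTop (𝓝 0))
    (hsecond : Tendsto (fun N => ∫ t, t ^ 2 ∂(ν N)) atTop (𝓝 (J ^ 2)))
    {B : ℝ} (hthird : ∀ᶠ N in atTop, ∫ t, |t| ^ 3 ∂(ν N) ≤ B) :
    Tendsto (fun N => quenchedDilutedGlass X β p (α N) (b N) (ν N) N
      - quenchedMeanFieldGlass X β p J₀ J N) atTop (𝓝 0) := by
  simp only [quenchedDilutedGlass_eq hX, quenchedMeanFieldGlass_eq hX]
  have hpow := tendsto_pow_atTop_of_scale hp hα hb hαb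
  have hq : (0 : ℝ) < p.factorial / 2 := by positivity
  have hs : Tendsto (fun N => √((p.factorial : ℝ) / (2 * scale (α N) (b N) p N))) atTop (𝓝 0) := by
    simpa using (tendsto_factorial_div_scale hαb).sqrt
  have hs' : Tendsto (fun N : ℕ => √((p.factorial : ℝ) / (2 * (N : ℝ) ^ (p - 1)))) atTop (𝓝 0) := by
    simpa using (tendsto_const_nhds.div_atTop (hpow.const_mul_atTop two_pos) :
      Tendsto (fun N : ℕ => (p.factorial : ℝ) / (2 * (N : ℝ) ^ (p - 1))) atTop (𝓝 0)).sqrt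
  have hev := (eventually_ge_atTop 1).and (hαb.eventually_gt_atTop 0)
  have hmap : ∀ {f : ℝ → ℝ}, Continuous f → (∀ x y, f (x * y) = f x * f y) →
      ∀ (c : ℝ) (ρ : Measure ℝ), ∫ t, f t ∂(ρ.map fun t => c * t) = f c * ∫ t, f t ∂ρ := by
    intro f hf hmul c ρ
    rw [integral_map (by fun_prop) hf.aestronglyMeasurable]
    simp only [hmul]
    rw [integral_const_mul]
  refine tendsto_integral_freeEnergy_sub hX hp hβ (fun N => inferInstance)
    (fun N => Measure.isProbabilityMeasure_map (by fun_prop))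
    (fun N => integrable_dilutedCouplingLaw (hν N)) (fun N => ?_) ?_ ?_ ?_ ?_
  · rw [integrable_map_measure (by fun_prop) (by fun_prop)]
    refine ((integrable_abs_pow_three_gaussianReal _ _).const_mul
      (|√((p.factorial : ℝ) / (2 * (N : ℝ) ^ (p - 1)))| ^ 3)).congr (ae_of_all _ fun t => ?_)
    simp [abs_mul, mul_pow]
  · have h := (hmean.abs).const_mul √((p.factorial : ℝ) / 2)
    rw [abs_zero, mul_zero] at h
    refine h.congr' ?_
    filter_upwards [hev] with N hN
    have hN0 : (0 : ℝ) < N := by exact_mod_cast hN.1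
    have hx := hN.2
    have := hνp N
    rw [integral_dilutedCouplingLaw (hα N) (hb N) hp hN.1 (f := fun t => t) (by fun_prop) (by simp)
      rfl rfl, hmap (f := fun t => t) (by fun_prop) (by simp), integral_id_gaussianReal]
    refine mul_abs_eq_mul_abs (by positivity) (by positivity) ?_
    -- with `q = p! / 2` and `n = N ^ (p - 1)`, the diluted mean times `n` is
    -- `n √(q / x) (x / n) E[J_d] = √q √x E[J_d]`, and the mean-field one is
    -- `n √(q / n) · J₀ √(q / n) = q J₀ = √q √x · J₀ √(q / x)`
    set x := scale (α N) (b N) p N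
    set n := (N : ℝ) ^ (p - 1)
    have hn0 : 0 < n := by positivity
    have e1 : √((p.factorial : ℝ) / (2 * x)) = √((p.factorial : ℝ) / 2) / √x := by
      rw [← Real.sqrt_div hq.le, div_div]
    have e2 : √((p.factorial : ℝ) / (2 * n)) = √((p.factorial : ℝ) / 2) / √n := by
      rw [← Real.sqrt_div hq.le, div_div]
    have ex := Real.sq_sqrt hx.le
    have en := Real.sq_sqrt hn0.le
    have hx' := Real.sqrt_pos.2 hx
    have hn' := Real.sqrt_pos.2 hn0
    rw [e1, e2, ← ex, ← en, Real.sqrt_sq hx'.le, Real.sqrt_sq hn'.le]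
    field_simp
  · have h : Tendsto (fun N : ℕ => (p.factorial : ℝ) / 2 * |(∫ t, t ^ 2 ∂(ν N)) - (J ^ 2
        + (J₀ * √((p.factorial : ℝ) / (2 * (N : ℝ) ^ (p - 1)))) ^ 2)|) atTop (𝓝 0) := by
      have := ((hsecond.sub (((hs'.const_mul J₀).pow 2).const_add (J ^ 2))).abs).const_mul
        ((p.factorial : ℝ) / 2)
      simpa using this
    refine h.congr' ?_
    filter_upwards [hev] with N hN
    have hN0 : (0 : ℝ) < N := by exact_mod_cast hN.1
    have hx := hN.2
    have := hνp N
    rw [integral_dilutedCouplingLaw (hα N) (hb N) hp hN.1 (f := fun t => t ^ 2) (by fun_prop)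
      (fun x y => mul_pow x y 2) (by simp) (by simp), hmap (f := fun t => t ^ 2) (by fun_prop)
      (fun x y => mul_pow x y 2), integral_sq_gaussianReal, Real.coe_toNNReal _ (sq_nonneg J),
      Real.sq_sqrt (by positivity), Real.sq_sqrt (by positivity)]
    refine mul_abs_eq_mul_abs (by positivity) (by positivity) ?_
    field_simp
  · have h := (hs.const_mul ((p.factorial : ℝ) / 2)).mul_const B
    rw [mul_zero, zero_mul] at h
    refine squeeze_zero' (Eventually.of_forall fun N =>
      mul_nonneg (by positivity) (integral_nonneg fun t => by positivity)) ?_ h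
    filter_upwards [hev, hthird] with N hN hB
    have hN0 : (0 : ℝ) < N := by exact_mod_cast hN.1
    have hx := hN.2
    have := hνp N
    rw [integral_dilutedCouplingLaw (hα N) (hb N) hp hN.1 (f := fun t => |t| ^ 3) (by fun_prop)
      (fun x y => by rw [abs_mul, mul_pow]) (by simp) (by simp), abs_of_nonneg (Real.sqrt_nonneg _),
      pow_succ, Real.sq_sqrt (by positivity)]
    refine le_trans (le_of_eq ?_) (mul_le_mul_of_nonneg_left hB (by positivity))
    field_simp
  · set m : ℕ → ℝ := fun N => J₀ * √((p.factorial : ℝ) / (2 * (N : ℝ) ^ (p - 1)))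
    have hm0 : Tendsto m atTop (𝓝 0) := by
      rw [← mul_zero J₀]; exact hs'.const_mul J₀
    have h := (hs'.const_mul ((p.factorial : ℝ) / 2)).mul (((hm0.abs.pow 3).const_add
      (∫ t, |t| ^ 3 ∂(gaussianReal 0 (Real.toNNReal (J ^ 2))))).const_mul 4)
    rw [mul_zero, zero_mul] at h
    refine squeeze_zero' (Eventually.of_forall fun N =>
      mul_nonneg (by positivity) (integral_nonneg fun t => by positivity)) ?_ h
    filter_upwards [eventually_ge_atTop 1] with N hN
    have hN0 : (0 : ℝ) < N := by exact_mod_cast hN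
    rw [hmap (f := fun t => |t| ^ 3) (by fun_prop) (fun x y => by rw [abs_mul, mul_pow]),
      abs_of_nonneg (Real.sqrt_nonneg _), pow_succ, Real.sq_sqrt (by positivity)]
    change (N : ℝ) ^ (p - 1) * (_ * ∫ t, |t| ^ 3 ∂(gaussianReal (m N) (Real.toNNReal (J ^ 2)))) ≤ _
    refine le_trans (le_of_eq ?_) (mul_le_mul_of_nonneg_left
      (integral_abs_pow_three_gaussianReal_le (m N) _) (by positivity))
    field_simp

theorem tendsto_iff_of_sub_tendsto_zero {u v : ℕ → ℝ}
    (h : Tendsto (fun N => u N - v N) atTop (𝓝 0)) (f : ℝ) :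
    Tendsto u atTop (𝓝 f) ↔ Tendsto v atTop (𝓝 f) :=
  ⟨fun hu => by simpa using hu.sub h, fun hv => by simpa using h.add hv⟩

end Comparison

end DilutedPSpin

open DilutedPSpin in
theorem theorem1 (X : Finset ℝ) (hX : X.Nonempty) (p : ℕ) (hp : 1 ≤ p)
    (β : ℝ) (hβ : 0 < β) (J₀ J : ℝ) (hJ₀ : 0 ≤ J₀) (hJ : 0 < J) (α b : ℕ → ℝ)
    (hα : ∀ N, α N ∈ Set.Ioc (0 : ℝ) 1) (hb : ∀ N, b N ∈ Set.Ioc (0 : ℝ) 1)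
    (hαb : Tendsto (fun N => DilutedPSpin.scale (α N) (b N) p N) atTop atTop) :
    (∀ f : ℝ,
      Tendsto (fun N => DilutedPSpin.quenchedDilutedFerro X β p (α N) (b N) N) atTop (𝓝 f) ↔
        Tendsto (fun N => DilutedPSpin.meanFieldFerro X β p N) atTop (𝓝 f)) ∧
    (∀ f : ℝ,
      Tendsto (fun N => DilutedPSpin.quenchedDilutedGlass X β p (α N) (b N)
          (DilutedPSpin.gaussianCoupling J₀ J (α N) (b N) p N) N) atTop (𝓝 f) ↔
        Tendsto (fun N => DilutedPSpin.quenchedMeanFieldGlass X β p J₀ J N) atTop (𝓝 f)) ∧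
    (∀ ν : ℕ → Measure ℝ, DilutedPSpin.IsBoundedDiscreteCoupling J₀ J p α b ν →
      ∀ f : ℝ,
        Tendsto (fun N => DilutedPSpin.quenchedDilutedGlass X β p (α N) (b N) (ν N) N)
            atTop (𝓝 f) ↔
          Tendsto (fun N => DilutedPSpin.quenchedMeanFieldGlass X β p J₀ J N) atTop (𝓝 f)) := by
  refine ⟨tendsto_iff_of_sub_tendsto_zero
      (tendsto_quenchedDilutedFerro_sub hX hp hβ hα hb hαb),
    tendsto_iff_of_sub_tendsto_zero ?_, fun ν hν => tendsto_iff_of_sub_tendsto_zero ?_⟩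
  · set m : ℕ → ℝ := fun N => J₀ * √((p.factorial : ℝ) / (2 * scale (α N) (b N) p N))
    have hm0 : Tendsto m atTop (𝓝 0) := by
      rw [← mul_zero J₀, ← Real.sqrt_zero]
      exact (tendsto_factorial_div_scale hαb).sqrt.const_mul J₀
    have hbound : Tendsto (fun N => 4 * (∫ t, |t| ^ 3 ∂(gaussianReal 0 (Real.toNNReal (J ^ 2)))
        + |m N| ^ 3)) atTop
        (𝓝 (4 * (∫ t, |t| ^ 3 ∂(gaussianReal 0 (Real.toNNReal (J ^ 2)))))) := by
      simpa using ((hm0.abs.pow 3).const_add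
        (∫ t, |t| ^ 3 ∂(gaussianReal 0 (Real.toNNReal (J ^ 2))))).const_mul 4
    refine tendsto_quenchedDilutedGlass_sub hX hp hβ hα hb hαb
      (fun N => by unfold gaussianCoupling; infer_instance)
      (fun N => integrable_abs_pow_three_gaussianReal _ _) ?_ ?_
      ((hbound.eventually_le_const (lt_add_one _)).mono fun N hN =>
        (integral_abs_pow_three_gaussianReal_le (m N) _).trans hN)
    · simp [gaussianCoupling, integral_id_gaussianReal]
    · simp only [gaussianCoupling, integral_sq_gaussianReal, Real.coe_toNNReal _ (sq_nonneg J)]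
      have h := (hm0.pow 2).const_add (J ^ 2)
      rwa [zero_pow two_ne_zero, add_zero] at h
  · obtain ⟨B, hB⟩ := hν.bounded
    have hprob := hν.isProbabilityMeasure
    have hae : ∀ N, ∀ᵐ t ∂(ν N), ‖|t| ^ 3‖ ≤ B ^ 3 := fun N => by
      have h : ∀ᵐ t ∂(ν N), t ∈ Set.Icc (-B) B := mem_ae_iff.2 (hB N)
      filter_upwards [h] with t ht
      rw [Real.norm_of_nonneg (by positivity)]
      exact pow_le_pow_left₀ (abs_nonneg t) (abs_le.2 ht) 3
    have hsqrt : Tendsto (fun N => √(scale (α N) (b N) p N)) atTop atTop :=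
      Real.tendsto_sqrt_atTop.comp hαb
    refine tendsto_quenchedDilutedGlass_sub hX hp hβ hα hb hαb hprob
      (fun N => Integrable.of_bound (by fun_prop) _ (hae N)) ?_ ?_
      (B := B ^ 3) (Eventually.of_forall fun N => ?_)
    · refine ((isBigO_refl _ _).mul hν.mean).trans_tendsto ?_
      refine hsqrt.inv_tendsto_atTop.congr' ?_
      filter_upwards [hαb.eventually_gt_atTop 0] with N hN
      have := Real.sqrt_pos.2 hN
      simp only [Pi.inv_apply]
      nth_rw 3 [← Real.sq_sqrt hN.le]
      field_simp
    · have := (hν.secondMoment.trans_tendsto hsqrt.inv_tendsto_atTop).add_const (J ^ 2)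
      simpa using this
    · refine (le_abs_self _).trans ?_
      simpa using norm_integral_le_of_norm_le_const (hae N)
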